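/- Let $G$ be a finite group and let $P$ be a set of prime numbers. Put $\mathbb{Z}_{(P)} := \mathbb{Z}[p^{-1} \mid p \text{ prime},\ p \notin P] \subseteq \mathbb{Q}$. Let $RU(G)$, $RO(G)$ and $R\mathbb{Q}(G)$ be the Grothendieck rings of finite-dimensional representations of $G$ over $\mathbb{C}$, $\mathbb{R}$ and $\mathbb{Q}$, respectively (with addition induced by $\oplus$ and multiplication induced by $\otimes$). An idempotent is called primitive if it is non-zero and is not a sum of two non-zero idempotents. Then extension of scalars induces injective ring homomorphisms $RO(G) \otimes_{\mathbb{Z}} \mathbb{Z}_{(P)} \to RU(G) \otimes_{\mathbb{Z}} \mathbb{Z}_{(P)}$ and $R\mathbb{Q}(G) \otimes_{\mathbb{Z}} \mathbb{Z}_{(P)} \to RU(G) \otimes_{\mathbb{Z}} \mathbb{Z}_{(P)}$, via which we regard the sources as subrings of $RU(G) \otimes_{\mathbb{Z}} \mathbb{Z}_{(P)}$. All primitive idempotents of $RU(G) \otimes_{\mathbb{Z}} \mathbb{Z}_{(P)}$ lie in both of these subrings. Consequently, the primitive idempotents of $RU(G) \otimes_{\mathbb{Z}} \mathbb{Z}_{(P)}$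 are precisely the primitive idempotents of $RO(G) \otimes_{\mathbb{Z}} \mathbb{Z}_{(P)}$, and they are precisely the primitive idempotents of $R\mathbb{Q}(G) \otimes_{\mathbb{Z}} \mathbb{Z}_{(P)}$. -/

import Mathlib

open scoped TensorProduct

noncomputable section

universe u v

namespace Representation

variable {K : Type*} (L : Type*) {G V W : Type*} [Field K] [Field L] [Algebra K L] [Group G]
  [AddCommGroup V] [Module K V] [AddCommGroup W] [Module K W]

/-- Extension of scalars: `g` acts on `L ⊗[K] V` by `id ⊗ ρ g`. -/
def extendScalars (ρ : Representation K G V) : Representation L G (L ⊗[K] V) :=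
  (Module.End.baseChangeHom K L V : Module.End K V →* Module.End L (L ⊗[K] V)).comp ρ

theorem extendScalars_apply (ρ : Representation K G V) (g : G) :
    ρ.extendScalars L g = (ρ g).baseChange L := rfl

/-- Equivalent representations stay equivalent after extension of scalars. -/
def extendScalarsCongr {ρ : Representation K G V} {σ : Representation K G W} (φ : ρ.Equiv σ) :
    (ρ.extendScalars L).Equiv (σ.extendScalars L) :=
  .mk (φ.toLinearEquiv.baseChange K L) fun g => by
    apply TensorProduct.AlgebraTensorModule.ext
    intro a x
    exact congrArg (a ⊗ₜ[K] ·) (φ.toIntertwiningMap.isIntertwining _ _ g x)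

/-- Extension of scalars preserves the trivial one-dimensional representation. -/
def extendScalarsTrivial :
    ((trivial K G K).extendScalars L).Equiv (trivial L G L) :=
  .mk (TensorProduct.AlgebraTensorModule.rid K L L) fun g => by
    apply TensorProduct.AlgebraTensorModule.ext
    intro a x
    rfl

/-- Extension of scalars commutes with tensor products. -/
def extendScalarsTprod (ρ : Representation K G V) (σ : Representation K G W) :
    ((ρ.tprod σ).extendScalars L).Equiv ((ρ.extendScalars L).tprod (σ.extendScalars L)) :=
  .mk (TensorProduct.AlgebraTensorModule.distribBaseChange K L V W) fun g => by
    apply TensorProduct.AlgebraTensorModule.ext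
    intro a x
    induction x using TensorProduct.induction_on with
    | zero => simp only [TensorProduct.tmul_zero, map_zero]
    | add x y hx hy => simp only [TensorProduct.tmul_add, map_add, hx, hy]
    | tmul x y => rfl

/-- Extension of scalars commutes with direct sums. -/
def extendScalarsProd (ρ : Representation K G V) (σ : Representation K G W) :
    ((ρ.prod σ).extendScalars L).Equiv ((ρ.extendScalars L).prod (σ.extendScalars L)) :=
  .mk (TensorProduct.prodRight K L L V W) fun g => by
    apply TensorProduct.AlgebraTensorModule.ext
    intro a x
    rfl

end Representation

/-- A finite-dimensional `K`-linear representation of `G`. -/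
structure FinRep (K : Type u) (G : Type v) [Field K] [Group G] where
  /-- The underlying vector space. -/
  V : Type u
  [addCommGroup : AddCommGroup V]
  [module : Module K V]
  [finite : FiniteDimensional K V]
  /-- The action of the group. -/
  ρ : Representation K G V

namespace FinRep

attribute [instance] FinRep.addCommGroup FinRep.module FinRep.finite

variable {K L : Type u} {G : Type v} [Field K] [Field L] [Algebra K L] [Group G]

/-- Isomorphism of representations, as a relation. -/
instance isoSetoid (K : Type u) (G : Type v) [Field K] [Group G] : Setoid (FinRep K G) where
  r A B := Nonempty (A.ρ.Equiv B.ρ)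
  iseqv :=
    ⟨fun A => ⟨.refl A.ρ⟩, fun ⟨φ⟩ => ⟨φ.symm⟩, fun ⟨φ⟩ ⟨ψ⟩ => ⟨φ.trans ψ⟩⟩

/-- The one-dimensional trivial representation. -/
def triv (K : Type u) (G : Type v) [Field K] [Group G] : FinRep K G where
  V := K
  ρ := Representation.trivial K G K

/-- The direct sum of two representations. -/
def directSum (A B : FinRep K G) : FinRep K G where
  V := A.V × B.V
  ρ := A.ρ.prod B.ρ

/-- The tensor product of two representations, with the diagonal action. -/
def tensor (A B : FinRep K G) : FinRep K G where
  V := A.V ⊗[K] B.V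
  ρ := A.ρ.tprod B.ρ

/-- The extension of scalars `L ⊗[K] V` of a representation. -/
def baseChange (L : Type u) [Field L] [Algebra K L] (A : FinRep K G) : FinRep L G where
  V := L ⊗[K] A.V
  ρ := A.ρ.extendScalars L

theorem tensor_congr {A A' B B' : FinRep K G} (h : A ≈ A') (h' : B ≈ B') :
    A.tensor B ≈ A'.tensor B' := by
  obtain ⟨φ⟩ := h
  obtain ⟨ψ⟩ := h'
  refine ⟨.mk (TensorProduct.congr φ.toLinearEquiv ψ.toLinearEquiv) fun g => ?_⟩
  apply TensorProduct.ext'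
  intro x y
  have h1 := φ.toIntertwiningMap.isIntertwining _ _ g x
  have h2 := ψ.toIntertwiningMap.isIntertwining _ _ g y
  exact congrArg₂ (· ⊗ₜ[K] ·) h1 h2

theorem baseChange_congr {A A' : FinRep K G} (h : A ≈ A') :
    A.baseChange L ≈ A'.baseChange L :=
  h.map (Representation.extendScalarsCongr L)

theorem baseChange_triv : (triv K G).baseChange L ≈ triv L G :=
  ⟨Representation.extendScalarsTrivial L⟩

theorem baseChange_tensor (A B : FinRep K G) :
    (A.tensor B).baseChange L ≈ (A.baseChange L).tensor (B.baseChange L) :=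
  ⟨Representation.extendScalarsTprod L A.ρ B.ρ⟩

theorem baseChange_directSum (A B : FinRep K G) :
    (A.directSum B).baseChange L ≈ (A.baseChange L).directSum (B.baseChange L) :=
  ⟨Representation.extendScalarsProd L A.ρ B.ρ⟩

end FinRep

/-- Isomorphism classes of finite-dimensional representations of `G` over `K`. -/
def RepClass (K : Type u) (G : Type v) [Field K] [Group G] : Type (max (u + 1) v) :=
  Quotient (FinRep.isoSetoid K G)

namespace RepClass

variable {K L : Type u} {G : Type v} [Field K] [Field L] [Algebra K L] [Group G]

/-- The isomorphism class of a representation. -/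
def mk (A : FinRep K G) : RepClass K G := Quotient.mk _ A

/-- Isomorphism classes form a commutative monoid under the tensor product. -/
instance : CommMonoid (RepClass K G) where
  mul := Quotient.map₂ FinRep.tensor fun _ _ h _ _ h' => FinRep.tensor_congr h h'
  one := mk (FinRep.triv K G)
  mul_assoc := by
    rintro ⟨A⟩ ⟨B⟩ ⟨C⟩
    exact Quotient.sound ⟨Representation.TensorProduct.assoc A.ρ B.ρ C.ρ⟩
  one_mul := by
    rintro ⟨A⟩
    exact Quotient.sound ⟨Representation.TensorProduct.lid K A.ρ⟩
  mul_one := by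
    rintro ⟨A⟩
    exact Quotient.sound ⟨Representation.TensorProduct.rid K A.ρ⟩
  mul_comm := by
    rintro ⟨A⟩ ⟨B⟩
    exact Quotient.sound ⟨Representation.TensorProduct.comm A.ρ B.ρ⟩

/-- Extension of scalars on isomorphism classes. -/
def baseChange (K L : Type u) (G : Type v) [Field K] [Field L] [Algebra K L] [Group G] :
    RepClass K G →* RepClass L G where
  toFun := Quotient.map (FinRep.baseChange L) fun _ _ h => FinRep.baseChange_congr h
  map_one' := Quotient.sound FinRep.baseChange_triv
  map_mul' := by
    rintro ⟨A⟩ ⟨B⟩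
    exact Quotient.sound (FinRep.baseChange_tensor A B)

end RepClass

/-- The additivity relations `[A ⊕ B] = [A] + [B]`, as an ideal in the free abelian group on
isomorphism classes of representations with the multiplication `[A] * [B] = [A ⊗ B]`. -/
def repRingRelations (K : Type u) (G : Type v) [Field K] [Group G] :
    Ideal (MonoidAlgebra ℤ (RepClass K G)) :=
  Ideal.span {x | ∃ A B : FinRep K G,
    x = MonoidAlgebra.of ℤ _ (RepClass.mk (A.directSum B)) -
      (MonoidAlgebra.of ℤ _ (RepClass.mk A) + MonoidAlgebra.of ℤ _ (RepClass.mk B))}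

/-- The representation ring of `G` over `K`: the Grothendieck ring of finite-dimensional
representations, with sum induced by `⊕` and product induced by `⊗`. -/
def RepRing (K : Type u) (G : Type v) [Field K] [Group G] : Type (max (u + 1) v) :=
  MonoidAlgebra ℤ (RepClass K G) ⧸ repRingRelations K G

namespace RepRing

instance (K : Type u) (G : Type v) [Field K] [Group G] : CommRing (RepRing K G) :=
  inferInstanceAs (CommRing (MonoidAlgebra ℤ (RepClass K G) ⧸ repRingRelations K G))

/-- The quotient map from the free abelian group on isomorphism classes. -/
def proj (K : Type u) (G : Type v) [Field K] [Group G] :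
    MonoidAlgebra ℤ (RepClass K G) →+* RepRing K G :=
  Ideal.Quotient.mk (repRingRelations K G)

/-- The class of a representation in the representation ring. -/
def cls {K : Type u} {G : Type v} [Field K] [Group G] (A : FinRep K G) : RepRing K G :=
  proj K G (MonoidAlgebra.of ℤ _ (RepClass.mk A))

variable (K L : Type u) (G : Type v) [Field K] [Field L] [Algebra K L] [Group G]

theorem repRingRelations_le_comap :
    repRingRelations K G ≤
      (repRingRelations L G).comap
        (MonoidAlgebra.mapDomainRingHom ℤ (RepClass.baseChange K L G)) := by
  refine Ideal.span_le.2 ?_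
  rintro _ ⟨A, B, rfl⟩
  refine Ideal.subset_span ⟨A.baseChange L, B.baseChange L, ?_⟩
  have h : RepClass.baseChange K L G (RepClass.mk (A.directSum B)) =
      RepClass.mk ((A.baseChange L).directSum (B.baseChange L)) :=
    Quotient.sound (FinRep.baseChange_directSum A B)
  simp only [map_sub, map_add, MonoidAlgebra.of_apply, MonoidAlgebra.mapDomainRingHom_apply,
    MonoidAlgebra.mapDomain_single, h]
  rfl

/-- Extension of scalars `[V] ↦ [L ⊗[K] V]` as a homomorphism of representation rings. -/
def baseChange : RepRing K G →+* RepRing L G :=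
  Ideal.quotientMap _ (MonoidAlgebra.mapDomainRingHom ℤ (RepClass.baseChange K L G))
    (repRingRelations_le_comap K L G)

theorem baseChange_cls (A : FinRep K G) : baseChange K L G (cls A) = cls (A.baseChange L) := by
  refine (Ideal.quotientMap_mk (H := repRingRelations_le_comap K L G)).trans ?_
  simp only [MonoidAlgebra.of_apply, MonoidAlgebra.mapDomainRingHom_apply,
    MonoidAlgebra.mapDomain_single]
  rfl

end RepRing

/-- The ring `ℤ[p⁻¹ | p ∉ P]` for a set `P` of prime numbers, as a subring of `ℚ`. -/
abbrev ZLoc (P : Set Nat.Primes) : Subalgebra ℤ ℚ :=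
  Algebra.adjoin ℤ {x : ℚ | ∃ p : Nat.Primes, p ∉ P ∧ x = ((p : ℕ) : ℚ)⁻¹}

/-- The `P`-local representation ring of `G` over `K`. -/
abbrev RepRingLoc (K : Type u) (G : Type v) [Field K] [Group G] (P : Set Nat.Primes) :
    Type (max (u + 1) v) :=
  RepRing K G ⊗[ℤ] ZLoc P

/-- Extension of scalars between `P`-local representation rings. -/
def RepRingLoc.baseChange (K L : Type u) (G : Type v) [Field K] [Field L] [Algebra K L] [Group G]
    (P : Set Nat.Primes) : RepRingLoc K G P →+* RepRingLoc L G P :=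
  (Algebra.TensorProduct.map (RepRing.baseChange K L G).toIntAlgHom
    (AlgHom.id ℤ (ZLoc P))).toRingHom

/-- The image of the `P`-local real representation ring in the complex one. -/
def realSubring (G : Type v) [Group G] (P : Set Nat.Primes) : Subring (RepRingLoc ℂ G P) :=
  (RepRingLoc.baseChange ℝ ℂ G P).range

/-- The image of the `P`-local rational representation ring in the complex one. -/
def ratSubring (G : Type v) [Group G] (P : Set Nat.Primes) : Subring (RepRingLoc ℂ G P) :=
  (RepRingLoc.baseChange ℚ ℂ G P).range

/-- A primitive idempotent: a non-zero idempotent that is not a sum of two non-zero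
idempotents. -/
def IsPrimitiveIdempotent {R : Type*} [Ring R] (e : R) : Prop :=
  IsIdempotentElem e ∧ e ≠ 0 ∧
    ∀ a b : R, IsIdempotentElem a → IsIdempotentElem b → e = a + b → a = 0 ∨ b = 0

end

/-!
The `P`-local representation rings are studied through their characters. Over a field of
characteristic zero a representation is determined by its character
(`FinRep.equiv_of_character_eq`), so the character map is injective on every localized
representation ring, and extension of scalars, which does not change characters, is injective too.

It remains to see that every idempotent `e` of the complex ring comes from any smaller field `K`
(`mem_range_baseChange_of_isIdempotentElem`). Its character is a function `f` with values `0` and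
`1`, and `d • f` is the character of a virtual representation for some `d` prime to `P`. An
integer-valued character `c` takes the same value at elements generating conjugate cyclic subgroups
(`integralCharacters.apply_eq_of_zpowers_eq`), and `c (g ^ p)` is congruent to `c g` modulo `p`
(`integralCharacters.dvd_apply_pow_sub`). Therefore `f` depends only on the conjugacy class of the
cyclic subgroup generated by an element, and for `p ∈ P` only on that of its component of order
prime to `p`.

Conversely, permutation characters are defined over every field. Modulo `p` they separate
non-conjugate cyclic subgroups of order prime to `p`: for such a subgroup `C` with normalizer `N`,
let `H` be the preimage in `N` of a Sylow `p`-subgroup of `N ⧸ C`. A generator of `C` has `[N : H]`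
fixed points on `G ⧸ H`, a number prime to `p`, and a cyclic subgroup that is at least as large, has
order prime to `p` and is not conjugate to `C` has none (`exists_subgroup_card_fixedBy`). Products
of such characters, shifted by constants, yield a multiple `m • f` with `p ∤ m` that is a character
over `K` (`exists_smul_mem_of_separates`). The integers `m` for which this holds form an ideal that
is non-zero and contained in no `(p)` with `p ∈ P`, so its generator is invertible in the
localization (`integralCharacters.exists_smul_mem`).
-/

noncomputable section

universe u v

/-! ### Characters determine representations in characteristic zero -/

namespace FinRep

variable {K : Type u} {G : Type v} [Field K] [Group G]

theorem character_congr {A B : FinRep K G} (h : A ≈ B) : A.ρ.character = B.ρ.character :=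
  let ⟨φ⟩ := h
  Representation.char_iso φ

theorem character_directSum (A B : FinRep K G) :
    (A.directSum B).ρ.character = A.ρ.character + B.ρ.character := by
  ext g
  exact LinearMap.trace_prodMap' (A.ρ g) (B.ρ g)

theorem character_tensor (A B : FinRep K G) :
    (A.tensor B).ρ.character = A.ρ.character * B.ρ.character :=
  Representation.char_tensor A.ρ B.ρ

theorem character_triv : (triv K G).ρ.character = 1 := by
  ext g
  exact (LinearMap.trace_one K K).trans (by simp)

theorem character_baseChange {L : Type u} [Field L] [Algebra K L] (A : FinRep K G) (g : G) :
    (A.baseChange L).ρ.character g = algebraMap K L (A.ρ.character g) :=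
  LinearMap.trace_baseChange (A.ρ g) L

theorem directSum_congr {A A' B B' : FinRep K G} (h : A ≈ A') (h' : B ≈ B') :
    A.directSum B ≈ A'.directSum B' := by
  obtain ⟨φ⟩ := h
  obtain ⟨ψ⟩ := h'
  refine ⟨.mk (φ.toLinearEquiv.prodCongr ψ.toLinearEquiv) fun g => ?_⟩
  refine LinearMap.ext fun x => Prod.ext ?_ ?_
  · exact φ.toIntertwiningMap.isIntertwining _ _ g x.1
  · exact ψ.toIntertwiningMap.isIntertwining _ _ g x.2

/-- The representation on a subrepresentation. -/
def ofSubrepresentation {A : FinRep K G} (S : Subrepresentation A.ρ) : FinRep K G where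
  V := S.toSubmodule
  ρ := S.toRepresentation

/-- A non-zero representation contains a non-zero subrepresentation all of whose
non-zero homomorphisms to other representations are injective. -/
theorem exists_simple (A : FinRep K G) [Nontrivial A.V] :
    ∃ (S : FinRep K G) (i : Representation.IntertwiningMap S.ρ A.ρ), Nontrivial S.V ∧
      Function.Injective i ∧ ∀ (B : FinRep K G) (f : Representation.IntertwiningMap S.ρ B.ρ),
        f ≠ 0 → Function.Injective f := by
  classical
  -- a non-zero representation embedding into `A`, of the smallest possible dimension
  have hex : ∃ n, ∃ S : FinRep K G, ∃ i : Representation.IntertwiningMap S.ρ A.ρ, Nontrivial S.V ∧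
      Function.Injective i ∧ Module.finrank K S.V = n :=
    ⟨_, A, Representation.IntertwiningMap.id A.ρ, inferInstance, Function.injective_id, rfl⟩
  obtain ⟨S, i, hS, hi, hn⟩ := Nat.find_spec hex
  refine ⟨S, i, hS, hi, fun B f hf => ?_⟩
  by_contra hinj
  have hker : LinearMap.ker f.toLinearMap ≠ ⊥ := fun h => hinj (LinearMap.ker_eq_bot.1 h)
  have hlt : Module.finrank K (LinearMap.ker f.toLinearMap) < Module.finrank K S.V := by
    refine Submodule.finrank_lt fun h => hf ?_
    exact Representation.IntertwiningMap.ext (LinearMap.ker_eq_top.1 h)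
  refine Nat.find_min hex (hn ▸ hlt) ⟨ofSubrepresentation f.ker,
    i.comp ⟨f.ker.toSubmodule.subtype, fun g => rfl⟩, ?_, ?_, rfl⟩
  · exact Submodule.nontrivial_iff_ne_bot.2 hker
  · exact hi.comp Subtype.val_injective

variable [Finite G] [CharZero K]

/-- A form of Maschke's theorem: a subrepresentation splits off as a direct summand. -/
theorem exists_directSum_of_injective {A B : FinRep K G}
    (f : Representation.IntertwiningMap A.ρ B.ρ) (hf : Function.Injective f) :
    ∃ C : FinRep K G, A.directSum C ≈ B := by
  have : NeZero (Nat.card G : K) := ⟨Nat.cast_ne_zero.2 Nat.card_pos.ne'⟩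
  obtain ⟨q, hq⟩ := exists_isCompl f.range
  refine ⟨ofSubrepresentation q, ⟨.mk (LinearEquiv.ofBijective
    (f.toLinearMap.coprod q.toSubmodule.subtype) ⟨?_, ?_⟩) fun g => ?_⟩⟩
  · rw [← LinearMap.ker_eq_bot, LinearMap.ker_eq_bot']
    rintro ⟨a, c⟩ hac
    have h : f a + c.1 = 0 := hac
    have hc : c.1 ∈ (f.range ⊓ q : Subrepresentation B.ρ).toSubmodule :=
      ⟨(Representation.IntertwiningMap.mem_range _ _ f _).2
        ⟨-a, by rw [map_neg]; exact neg_eq_of_add_eq_zero_right h⟩, c.2⟩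
    rw [hq.inf_eq_bot] at hc
    have hc0 : c.1 = 0 := hc
    have ha : f a = 0 := by rwa [hc0, add_zero] at h
    have ha0 : a = 0 := hf (by rw [ha, map_zero])
    exact Prod.ext ha0 (Subtype.ext hc0)
  · intro b
    have hb : b ∈ (f.range ⊔ q : Subrepresentation B.ρ).toSubmodule := by
      rw [hq.sup_eq_top]; exact Submodule.mem_top
    obtain ⟨_, ⟨a, rfl⟩, c, hc, rfl⟩ := Submodule.mem_sup.1 hb
    exact ⟨(a, ⟨c, hc⟩), rfl⟩
  · refine LinearMap.ext fun x => ?_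
    change f.toLinearMap (A.ρ g x.1) + B.ρ g x.2.1 = B.ρ g (f.toLinearMap x.1 + x.2.1)
    rw [map_add]
    exact congrArg (· + _) (f.isIntertwining _ _ g x.1)

open Module in
theorem finrank_intertwiningMap_eq {A B : FinRep K G} (h : A.ρ.character = B.ρ.character)
    (S : FinRep K G) : finrank K (Representation.IntertwiningMap S.ρ A.ρ) =
      finrank K (Representation.IntertwiningMap S.ρ B.ρ) := by
  have := Fintype.ofFinite G
  have := invertibleOfNonzero (Nat.cast_ne_zero.2 Nat.card_pos.ne' : (Nat.card G : K) ≠ 0)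
  have h1 := Representation.card_inv_mul_sum_char_mul_char_eq_finrank S.ρ A.ρ
  rw [h, Representation.card_inv_mul_sum_char_mul_char_eq_finrank S.ρ B.ρ] at h1
  exact_mod_cast h1.symm

/-- Over a field of characteristic zero, not necessarily algebraically closed, two representations
with the same character are isomorphic: a simple subrepresentation `S` of the first has as
many homomorphisms to the second, so it splits off from both. -/
theorem equiv_of_character_eq (A B : FinRep K G) (h : A.ρ.character = B.ρ.character) : A ≈ B := by
  induction hn : Module.finrank K A.V using Nat.strong_induction_on generalizing A B with
  | _ n ih =>
  have hdim : Module.finrank K A.V = Module.finrank K B.V := by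
    have := congrFun h 1
    rw [Representation.char_one, Representation.char_one] at this
    exact_mod_cast this
  rcases subsingleton_or_nontrivial A.V with hA | hA
  · have hB : Subsingleton B.V := by
      rw [← Module.finrank_zero_iff (R := K), ← hdim, Module.finrank_zero_iff]; exact hA
    exact ⟨.mk 0 fun g => LinearMap.ext fun x => Subsingleton.elim _ _⟩
  obtain ⟨S, i, hS, hi, hsimple⟩ := exists_simple A
  obtain ⟨j, hj⟩ : ∃ j : Representation.IntertwiningMap S.ρ B.ρ, j ≠ 0 := by
    by_contra! hzero
    have hsub : Subsingleton (Representation.IntertwiningMap S.ρ B.ρ) :=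
      ⟨fun a b => (hzero a).trans (hzero b).symm⟩
    have h0 := finrank_intertwiningMap_eq h S
    rw [Module.finrank_zero_of_subsingleton (M := Representation.IntertwiningMap S.ρ B.ρ),
      Module.finrank_zero_iff] at h0
    obtain ⟨x, hx⟩ := exists_ne (0 : S.V)
    exact hx (hi (by rw [Subsingleton.elim i 0, map_zero]; rfl))
  obtain ⟨A', hA'⟩ := exists_directSum_of_injective i hi
  obtain ⟨B', hB'⟩ := exists_directSum_of_injective j (hsimple B j hj)
  have hchar : A'.ρ.character = B'.ρ.character := by
    have := (character_congr hA').trans (h.trans (character_congr hB').symm)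
    rwa [character_directSum, character_directSum, add_right_inj] at this
  have hlt : Module.finrank K A'.V < n := by
    obtain ⟨φ⟩ := hA'
    have h1 : Module.finrank K (S.V × A'.V) = n := φ.toLinearEquiv.finrank_eq.trans hn
    rw [Module.finrank_prod] at h1
    have : 0 < Module.finrank K S.V := Module.finrank_pos
    omega
  exact Setoid.trans (Setoid.symm hA')
    (Setoid.trans (directSum_congr (Setoid.refl S) (ih _ hlt A' B' hchar rfl)) hB')

end FinRep

/-! ### The character homomorphism of the representation ring -/

namespace RepRing

variable (K : Type u) (G : Type v) [Field K] [Group G]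

/-- The character of an isomorphism class, multiplicative for the tensor product. -/
def characterClass : RepClass K G →* (G → K) where
  toFun := Quotient.lift (fun A : FinRep K G => A.ρ.character) fun _ _ h =>
    FinRep.character_congr h
  map_one' := FinRep.character_triv
  map_mul' := by
    rintro ⟨A⟩ ⟨B⟩
    exact FinRep.character_tensor A B

/-- The character of a virtual representation. -/
def character : RepRing K G →+* (G → K) :=
  Ideal.Quotient.lift _ (MonoidAlgebra.lift ℤ (G → K) (RepClass K G) (characterClass K G)).toRingHom
    fun x hx => by
      refine (Ideal.span_le (I := RingHom.ker _)).2 ?_ hx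
      rintro _ ⟨A, B, rfl⟩
      simp only [SetLike.mem_coe, RingHom.mem_ker, map_sub, map_add, AlgHom.toRingHom_eq_coe,
        RingHom.coe_coe, MonoidAlgebra.lift_of]
      exact sub_eq_zero.2 (FinRep.character_directSum A B)

variable {K G}

theorem character_cls (A : FinRep K G) : character K G (cls A) = A.ρ.character :=
  (Ideal.Quotient.lift_mk _ _ _).trans (MonoidAlgebra.lift_of _ _)

theorem cls_directSum (A B : FinRep K G) : cls (A.directSum B) = cls A + cls B := by
  refine (sub_eq_zero.1 ?_)
  exact (Ideal.Quotient.eq_zero_iff_mem.2 (Ideal.subset_span ⟨A, B, rfl⟩) :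
    proj K G _ = 0)

theorem cls_congr {A B : FinRep K G} (h : A ≈ B) : cls A = cls B :=
  congrArg (fun c => proj K G (MonoidAlgebra.of ℤ _ c)) (Quotient.sound h)

/-- The additive group of the representation ring is generated by the classes of
representations. -/
theorem induction {motive : RepRing K G → Prop} (cls : ∀ A, motive (cls A))
    (add : ∀ x y, motive x → motive y → motive (x + y)) (neg : ∀ x, motive x → motive (-x))
    (x : RepRing K G) : motive x := by
  obtain ⟨x, rfl⟩ := Ideal.Quotient.mk_surjective x
  have h0 : motive 0 := by
    have := add _ _ (cls (FinRep.triv K G)) (neg _ (cls (FinRep.triv K G)))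
    rwa [add_neg_cancel] at this
  induction x using MonoidAlgebra.induction_linear with
  | zero => exact h0
  | add f g hf hg => exact add _ _ hf hg
  | single c n =>
    obtain ⟨A, rfl⟩ := Quotient.exists_rep c
    have h1 : MonoidAlgebra.single (RepClass.mk A) n =
        n • MonoidAlgebra.of ℤ _ (RepClass.mk A) := by
      rw [MonoidAlgebra.of_apply, MonoidAlgebra.smul_single, smul_eq_mul, mul_one]
    change motive (proj K G (MonoidAlgebra.single (RepClass.mk A) n))
    rw [h1, map_zsmul]
    change motive (n • RepRing.cls A)
    clear h1
    induction n using Int.induction_on with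
    | zero => rw [zero_smul]; exact h0
    | succ n ih => rw [add_smul, one_smul]; exact add _ _ ih (cls A)
    | pred n ih => rw [sub_smul, one_smul, sub_eq_add_neg]; exact add _ _ ih (neg _ (cls A))

theorem exists_eq_cls_sub_cls (x : RepRing K G) : ∃ A B : FinRep K G, x = cls A - cls B := by
  induction x using induction with
  | cls A =>
    exact ⟨A.directSum A, A, by rw [cls_directSum, add_sub_cancel_right]⟩
  | add x y hx hy =>
    obtain ⟨A, B, rfl⟩ := hx
    obtain ⟨A', B', rfl⟩ := hy
    exact ⟨A.directSum A', B.directSum B', by rw [cls_directSum, cls_directSum]; abel⟩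
  | neg x hx =>
    obtain ⟨A, B, rfl⟩ := hx
    exact ⟨B, A, by abel⟩

theorem character_injective [Finite G] [CharZero K] : Function.Injective (character K G) := by
  refine (injective_iff_map_eq_zero _).2 fun x hx => ?_
  obtain ⟨A, B, rfl⟩ := exists_eq_cls_sub_cls x
  rw [map_sub, character_cls, character_cls, sub_eq_zero] at hx
  rw [cls_congr (FinRep.equiv_of_character_eq A B hx), sub_self]

theorem character_baseChange (L : Type u) [Field L] [Algebra K L] (x : RepRing K G) (g : G) :
    character L G (baseChange K L G x) g = algebraMap K L (character K G x g) := by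
  induction x using induction with
  | cls A => rw [baseChange_cls, character_cls, character_cls, FinRep.character_baseChange]
  | add x y hx hy => simp only [map_add, Pi.add_apply, hx, hy]
  | neg x hx => simp only [map_neg, Pi.neg_apply, hx]

end RepRing

/-! ### Values of complex characters -/

open Polynomial in
/-- The traces of the powers of an endomorphism of finite order `n` are obtained by evaluating
a single integral polynomial at the powers of a primitive `n`-th root of unity. -/
theorem exists_trace_pow_eq_aeval {V : Type*} [AddCommGroup V] [Module ℂ V]
    [FiniteDimensional ℂ V] (f : Module.End ℂ V) {n : ℕ} (hn : n ≠ 0) (hf : f ^ n = 1)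
    {ζ : ℂ} (hζ : IsPrimitiveRoot ζ n) :
    ∃ Q : ℤ[X], ∀ j : ℕ, LinearMap.trace ℂ V (f ^ j) = aeval (ζ ^ j) Q := by
  have : NeZero n := ⟨hn⟩
  have hss : f.IsSemisimple := by
    refine Module.End.isSemisimple_of_squarefree_aeval_eq_zero (p := X ^ n - 1) ?_ (by simp [hf])
    exact (Polynomial.separable_X_pow_sub_C (1 : ℂ) (Nat.cast_ne_zero.2 hn) one_ne_zero).squarefree
  have heig : ∀ μ, f.maxGenEigenspace μ = f.eigenspace μ :=
    hss.isFinitelySemisimple.maxGenEigenspace_eq_eigenspace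
  have hint : DirectSum.IsInternal f.eigenspace := by
    refine DirectSum.isInternal_submodule_of_iSupIndep_of_iSup_eq_top f.eigenspaces_iSupIndep ?_
    simpa only [heig] using Module.End.iSup_maxGenEigenspace_eq_top f
  have hfin : {μ | f.eigenspace μ ≠ ⊥}.Finite :=
    WellFoundedGT.finite_ne_bot_of_iSupIndep f.eigenspaces_iSupIndep
  have hpow : ∀ μ x, x ∈ f.eigenspace μ → ∀ j : ℕ, (f ^ j) x = μ ^ j • x := by
    intro μ x hx j
    induction j with
    | zero => simp
    | succ j ih =>
      rw [pow_succ', Module.End.mul_apply, ih, map_smul, Module.End.mem_eigenspace_iff.1 hx,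
        smul_smul, ← pow_succ]
  have hroot : ∀ μ, f.eigenspace μ ≠ ⊥ → ∃ i : ℕ, ζ ^ i = μ := by
    intro μ hμ
    obtain ⟨x, hx, hx0⟩ := Submodule.exists_mem_ne_zero_of_ne_bot hμ
    have h1 := hpow μ x hx n
    rw [hf, Module.End.one_apply] at h1
    have h2 : μ ^ n = 1 := by
      refine smul_left_injective ℂ hx0 ?_
      change μ ^ n • x = (1 : ℂ) • x
      rw [one_smul, ← h1]
    obtain ⟨i, -, hi⟩ := hζ.eq_pow_of_pow_eq_one h2
    exact ⟨i, hi⟩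
  choose! i hi using hroot
  refine ⟨∑ μ ∈ hfin.toFinset, (Module.finrank ℂ (f.eigenspace μ) : ℤ[X]) * X ^ i μ, fun j => ?_⟩
  have hmaps : ∀ μ, Set.MapsTo (f ^ j) (f.eigenspace μ) (f.eigenspace μ) := fun μ x hx => by
    rw [hpow μ x hx]; exact Submodule.smul_mem _ _ hx
  rw [LinearMap.trace_eq_sum_trace_restrict' hint hfin hmaps, map_sum]
  refine Finset.sum_congr rfl fun μ hμ => ?_
  have hres : (f ^ j).restrict (hmaps μ) = μ ^ j • LinearMap.id := by
    ext x
    exact hpow μ x x.2 j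
  rw [hres, map_smul, LinearMap.trace_id, map_mul, map_natCast, map_pow, aeval_X, ← pow_mul,
    mul_comm j, pow_mul, hi μ (by simpa using hμ), smul_eq_mul, mul_comm]

namespace RepRing

variable {G : Type v} [Group G] [Finite G]

open Polynomial in
theorem exists_character_pow_eq_aeval (x : RepRing ℂ G) (g : G) {ζ : ℂ}
    (hζ : IsPrimitiveRoot ζ (orderOf g)) :
    ∃ Q : ℤ[X], ∀ j : ℕ, character ℂ G x (g ^ j) = aeval (ζ ^ j) Q := by
  induction x using induction with
  | cls A =>
    obtain ⟨Q, hQ⟩ := exists_trace_pow_eq_aeval (A.ρ g) (orderOf_pos g).ne'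
      (by rw [← map_pow, pow_orderOf_eq_one, map_one]) hζ
    exact ⟨Q, fun j => by rw [character_cls, ← hQ, ← map_pow]; rfl⟩
  | add x y hx hy =>
    obtain ⟨Q, hQ⟩ := hx
    obtain ⟨R, hR⟩ := hy
    exact ⟨Q + R, fun j => by rw [map_add, Pi.add_apply, hQ, hR, map_add]⟩
  | neg x hx =>
    obtain ⟨Q, hQ⟩ := hx
    exact ⟨-Q, fun j => by rw [map_neg, Pi.neg_apply, hQ, map_neg]⟩

end RepRing

/-- The ring of integer-valued functions on `G` that are characters of virtual representations
of `G` over `K`. -/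
def integralCharacters (K : Type u) (G : Type v) [Field K] [Group G] : Subring (G → ℤ) :=
  (RepRing.character K G).range.comap ((Int.castRingHom K).compLeft G)

namespace integralCharacters

variable {K : Type u} {G : Type v} [Field K] [Group G]

theorem mem_iff {f : G → ℤ} :
    f ∈ integralCharacters K G ↔ ∃ x, ∀ g, RepRing.character K G x g = f g :=
  exists_congr fun _ => funext_iff

theorem le_baseChange {L : Type u} [Field L] [Algebra K L] :
    integralCharacters K G ≤ integralCharacters L G := by
  intro f hf
  obtain ⟨x, hx⟩ := mem_iff.1 hf
  exact mem_iff.2 ⟨RepRing.baseChange K L G x, fun g => by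
    rw [RepRing.character_baseChange, hx, map_intCast]⟩

theorem apply_conj {f : G → ℤ} (hf : f ∈ integralCharacters ℂ G) (g x : G) :
    f (g * x * g⁻¹) = f x := by
  obtain ⟨y, hy⟩ := mem_iff.1 hf
  have h : RepRing.character ℂ G y (g * x * g⁻¹) = RepRing.character ℂ G y x := by
    obtain ⟨A, B, rfl⟩ := RepRing.exists_eq_cls_sub_cls y
    simp only [map_sub, Pi.sub_apply, RepRing.character_cls, Representation.char_conj]
  rw [hy, hy] at h
  exact_mod_cast h

variable [Finite G]

open Polynomial in
/-- Galois invariance: an integral value of a character at `g` is also its value at the other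
generators of the cyclic group generated by `g`, because the primitive roots of unity of a given
order have the same minimal polynomial. -/
theorem apply_pow_of_coprime {f : G → ℤ} (hf : f ∈ integralCharacters ℂ G) (g : G) {j : ℕ}
    (hj : j.Coprime (orderOf g)) : f (g ^ j) = f g := by
  obtain ⟨x, hx⟩ := mem_iff.1 hf
  have hζ := Complex.isPrimitiveRoot_exp (orderOf g) (orderOf_pos g).ne'
  obtain ⟨Q, hQ⟩ := RepRing.exists_character_pow_eq_aeval x g hζ
  have h1 := hQ 1
  rw [pow_one, pow_one, hx] at h1
  have hdvd := minpoly.isIntegrallyClosed_dvd (hζ.isIntegral (orderOf_pos g))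
    (p := Q - C (f g)) (by simp [← h1])
  rw [hζ.minpoly_eq_pow_coprime hj] at hdvd
  obtain ⟨R, hR⟩ := hdvd
  have h2 := congrArg (aeval (Complex.exp (2 * Real.pi * Complex.I / orderOf g) ^ j)) hR
  rw [map_mul, minpoly.aeval, zero_mul, map_sub, ← hQ, hx, aeval_C, sub_eq_zero,
    eq_intCast] at h2
  exact_mod_cast h2

open Polynomial in
/-- The Frobenius congruence, from `Q(X) ^ p ≡ Q(X ^ p)` modulo `p`. -/
theorem dvd_apply_pow_sub {f : G → ℤ} (hf : f ∈ integralCharacters ℂ G) (g : G) {p : ℕ}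
    (hp : p.Prime) : (p : ℤ) ∣ f (g ^ p) - f g := by
  have := Fact.mk hp
  obtain ⟨x, hx⟩ := mem_iff.1 hf
  have hζ := Complex.isPrimitiveRoot_exp (orderOf g) (orderOf_pos g).ne'
  obtain ⟨Q, hQ⟩ := RepRing.exists_character_pow_eq_aeval x g hζ
  set ζ := Complex.exp (2 * Real.pi * Complex.I / orderOf g)
  obtain ⟨R, hR⟩ : C (p : ℤ) ∣ expand ℤ p Q - Q ^ p := by
    rw [C_dvd_iff_dvd_coeff]
    intro i
    have h : (expand ℤ p Q - Q ^ p).map (Int.castRingHom (ZMod p)) = 0 := by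
      rw [Polynomial.map_sub, map_expand, Polynomial.map_pow, ZMod.expand_card, sub_self]
    rw [← CharP.intCast_eq_zero_iff (ZMod p) p]
    simpa only [coeff_map, eq_intCast, coeff_zero] using congrArg (coeff · i) h
  have h1 := congrArg (aeval ζ) hR
  rw [map_sub, expand_aeval, map_pow, ← hQ, ← pow_one ζ, ← hQ, pow_one, pow_one, hx, hx, map_mul,
    aeval_C] at h1
  have hint : IsIntegral ℤ (aeval ζ R) :=
    IsIntegral.of_mem_of_fg _ (hζ.isIntegral (orderOf_pos g)).fg_adjoin_singleton _
      (aeval_mem_adjoin_singleton ℤ ζ)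
  have hp0 : (p : ℂ) ≠ 0 := Nat.cast_ne_zero.2 hp.ne_zero
  -- the quotient is rational and an algebraic integer, hence an integer
  have h2 : aeval ζ R = algebraMap ℚ ℂ ((f (g ^ p) - f g ^ p : ℤ) / p) := by
    rw [eq_comm]
    simp at h1 ⊢
    field_simp
    rw [h1]
  rw [h2, isIntegral_algebraMap_iff (algebraMap ℚ ℂ).injective] at hint
  obtain ⟨m, hm⟩ := IsIntegrallyClosed.isIntegral_iff.1 hint
  have h3 : f (g ^ p) - f g ^ p = p * m := by
    have : (p : ℚ) ≠ 0 := Nat.cast_ne_zero.2 hp.ne_zero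
    rw [eq_div_iff this, eq_intCast] at hm
    have hm' : m * p = f (g ^ p) - f g ^ p := by exact_mod_cast hm
    rw [← hm', mul_comm]
  have h4 : (p : ℤ) ∣ f g ^ p - f g := by
    rw [← CharP.intCast_eq_zero_iff (ZMod p) p]
    simp [ZMod.pow_card]
  have := dvd_add (Dvd.intro _ h3.symm) h4
  rwa [sub_add_sub_cancel] at this

theorem dvd_apply_pow_prime_pow_sub {f : G → ℤ} (hf : f ∈ integralCharacters ℂ G) (g : G) {p : ℕ}
    (hp : p.Prime) (k : ℕ) : (p : ℤ) ∣ f (g ^ p ^ k) - f g := by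
  induction k with
  | zero => simp
  | succ k ih =>
    rw [pow_succ, pow_mul]
    have := dvd_add (dvd_apply_pow_sub hf (g ^ p ^ k) hp) ih
    rwa [sub_add_sub_cancel] at this

/-- Integral characters take the same value at elements generating conjugate cyclic subgroups. -/
theorem apply_eq_of_zpowers_eq {f : G → ℤ} (hf : f ∈ integralCharacters ℂ G) {x y : G} (g : G)
    (h : Subgroup.zpowers (g * x * g⁻¹) = Subgroup.zpowers y) : f x = f y := by
  rw [← apply_conj hf g x]
  generalize g * x * g⁻¹ = z at h ⊢
  obtain ⟨j, rfl⟩ : ∃ j : ℕ, z ^ j = y := by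
    refine Submonoid.mem_powers_iff _ _ |>.1 (mem_powers_iff_mem_zpowers.2 ?_)
    rw [h]
    exact Subgroup.mem_zpowers y
  refine (apply_pow_of_coprime hf z ?_).symm
  have h1 : orderOf (z ^ j) = orderOf z := by
    rw [← Nat.card_zpowers, ← Nat.card_zpowers, h]
  rw [orderOf_pow, Nat.div_eq_self] at h1
  exact Nat.Coprime.symm (h1.resolve_left (orderOf_pos z).ne')

end integralCharacters

/-! ### Permutation characters -/

/-- The permutation representation of an action on `n` points, on the functions on these points.
The set `Fin n` keeps the underlying space in the universe of `K`, whatever that of `G`. -/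
def FinRep.ofPerm (K : Type u) {G : Type v} [Field K] [Group G] {n : ℕ}
    (φ : G →* Equiv.Perm (Fin n)) : FinRep K G where
  V := Fin n → K
  ρ :=
    { toFun := fun g => LinearMap.funLeft K K (φ g⁻¹)
      map_one' := by ext; simp
      map_mul' := fun g h => by
        refine LinearMap.ext fun v => funext fun i => ?_
        simp [LinearMap.funLeft_apply] }

theorem FinRep.character_ofPerm (K : Type u) {G : Type v} [Field K] [Group G] {n : ℕ}
    (φ : G →* Equiv.Perm (Fin n)) (g : G) :
    (FinRep.ofPerm K φ).ρ.character g = Nat.card {i // φ g i = i} := by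
  have h : (FinRep.ofPerm K φ).ρ.character g =
      LinearMap.trace K (Fin n → K) (LinearMap.funLeft K K (φ g⁻¹)) := rfl
  have hfix : ∀ i, φ g⁻¹ i = i ↔ φ g i = i := fun i => by
    rw [map_inv, Equiv.Perm.inv_eq_iff_eq, eq_comm]
  rw [h, LinearMap.trace_eq_matrix_trace K (Pi.basisFun K (Fin n)), Matrix.trace,
    Nat.card_eq_fintype_card, Fintype.card_subtype, ← Finset.sum_boole]
  refine Finset.sum_congr rfl fun i _ => ?_
  simp [LinearMap.funLeft_apply, Pi.single_apply, ← hfix i]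

theorem integralCharacters.card_fixedBy_mem (K : Type u) (G : Type v) [Field K] [Group G]
    (X : Type*) [MulAction G X] [Finite X] :
    (fun g => (Nat.card (MulAction.fixedBy X g) : ℤ)) ∈ integralCharacters K G := by
  let e := Finite.equivFin X
  let φ : G →* Equiv.Perm (Fin (Nat.card X)) :=
    (e.permCongrHom : Equiv.Perm X →* _).comp (MulAction.toPermHom G X)
  refine mem_iff.2 ⟨RepRing.cls (FinRep.ofPerm K φ), fun g => ?_⟩
  rw [RepRing.character_cls, FinRep.character_ofPerm, Int.cast_natCast]
  congr 1
  refine Nat.card_congr (e.symm.subtypeEquiv fun i => ?_)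
  change e (g • e.symm i) = i ↔ g • e.symm i = e.symm i
  rw [← Equiv.eq_symm_apply]

section CyclicSubgroups

open MulAction

variable {G : Type v} [Group G]

theorem mem_fixedBy_quotient_mk_iff (H : Subgroup G) (x g : G) :
    (g : G ⧸ H) ∈ fixedBy (G ⧸ H) x ↔ g⁻¹ * x * g ∈ H := by
  rw [mem_fixedBy, Quotient.smul_coe, eq_comm, QuotientGroup.eq, smul_eq_mul, mul_assoc]

theorem orderOf_conj (g x : G) : orderOf (g * x * g⁻¹) = orderOf x :=
  MulEquiv.orderOf_eq (MulAut.conj g) x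

variable [Finite G]

theorem zpowers_conj_eq_of_orderOf_le {x y g : G} (h : g * y * g⁻¹ ∈ Subgroup.zpowers x)
    (hxy : orderOf x ≤ orderOf y) : Subgroup.zpowers (g * y * g⁻¹) = Subgroup.zpowers x := by
  refine Subgroup.eq_of_le_of_card_ge (Subgroup.zpowers_le.2 h) ?_
  rwa [Nat.card_zpowers, Nat.card_zpowers, orderOf_conj]

/-- For `x` of order prime to `p`, there is a subgroup `H` such that the number of fixed points of
`x` on `G ⧸ H` is prime to `p`, and the only elements of order prime to `p` that have a fixed point
are conjugate to elements of `⟨x⟩`: take for `H ⧸ ⟨x⟩` a Sylow `p`-subgroup of the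
quotient `N ⧸ ⟨x⟩`, where `N` is the normalizer of `⟨x⟩`. -/
theorem exists_subgroup_card_fixedBy {p : ℕ} (hp : p.Prime) (x : G) (hx : ¬p ∣ orderOf x) :
    ∃ H : Subgroup G, ¬p ∣ Nat.card (fixedBy (G ⧸ H) x) ∧
      ∀ y : G, ¬p ∣ orderOf y → (fixedBy (G ⧸ H) y).Nonempty →
        ∃ g, g * y * g⁻¹ ∈ Subgroup.zpowers x := by
  have := Fact.mk hp
  set C := Subgroup.zpowers x with hC
  set N := Subgroup.normalizer (C : Set G) with hN
  let π : N →* N ⧸ C.subgroupOf N := QuotientGroup.mk' _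
  obtain ⟨S⟩ : Nonempty (Sylow p (N ⧸ C.subgroupOf N)) := inferInstance
  let K : Subgroup N := (S : Subgroup _).comap π
  let H : Subgroup G := K.map N.subtype
  have hCH : C ≤ H := fun c hc => by
    refine ⟨⟨c, Subgroup.le_normalizer hc⟩, ?_, rfl⟩
    have h1 : π ⟨c, Subgroup.le_normalizer hc⟩ = 1 := (QuotientGroup.eq_one_iff _).2 hc
    change π _ ∈ (S : Subgroup _)
    rw [h1]
    exact one_mem _
  -- the elements of `H` of order prime to `p` lie in `C`, since `H ⧸ C` is a `p`-group
  have hHC : ∀ h ∈ H, ¬p ∣ orderOf h → h ∈ C := by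
    rintro _ ⟨h, hh, rfl⟩ hord
    have hord' : ¬p ∣ orderOf h := by rwa [← Subgroup.orderOf_coe]
    obtain ⟨k, hk⟩ := S.2 ⟨π h, hh⟩
    have h1 : orderOf (π h) ∣ p ^ k := orderOf_dvd_of_pow_eq_one (congrArg Subtype.val hk)
    have h2 : orderOf (π h) = 1 := by
      refine Nat.eq_one_of_dvd_coprimes ?_ h1 (orderOf_map_dvd π h)
      exact Nat.Coprime.pow_left k ((Nat.Prime.coprime_iff_not_dvd hp).2 hord')
    exact (QuotientGroup.eq_one_iff h).1 (orderOf_eq_one_iff.1 h2)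
  refine ⟨H, ?_, ?_⟩
  · have hsmul : ∀ n : N, n • ((1 : G) : G ⧸ H) = ((n : G) : G ⧸ H) := fun n =>
      congrArg _ (mul_one (n : G))
    have horb : fixedBy (G ⧸ H) x = orbit N ((1 : G) : G ⧸ H) := by
      ext q
      obtain ⟨g, rfl⟩ := QuotientGroup.mk_surjective q
      rw [mem_fixedBy_quotient_mk_iff]
      constructor
      · intro hg
        have h1 : g⁻¹ * x * g⁻¹⁻¹ ∈ C := hHC _ (by simpa using hg) (by rwa [orderOf_conj])
        have h2 : g⁻¹ ∈ N := by
          rw [hN, Subgroup.mem_normalizer_iff_map_conj_eq, MonoidHom.map_zpowers]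
          exact zpowers_conj_eq_of_orderOf_le h1 le_rfl
        exact ⟨⟨g, inv_mem_iff.1 h2⟩, hsmul _⟩
      · rintro ⟨n, hn⟩
        have h1 : (n : G)⁻¹ * g ∈ H := QuotientGroup.eq.1 ((hsmul n).symm.trans hn)
        have h2 : (n : G)⁻¹ * x * n ∈ C :=
          (Subgroup.mem_normalizer_iff''.1 n.2 x).1 (Subgroup.mem_zpowers x)
        have h3 := H.mul_mem (H.mul_mem (H.inv_mem h1) (hCH h2)) h1
        convert h3 using 1
        group
    have hstab : stabilizer N ((1 : G) : G ⧸ H) = K := by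
      ext n
      rw [mem_stabilizer_iff, hsmul, eq_comm, QuotientGroup.eq, inv_one, one_mul]
      exact Subgroup.mem_map_iff_mem N.subtype_injective
    -- the fixed points of `x` form an orbit of `N` of length `[N : H]`
    rw [horb, Nat.card_coe_set_eq, ← index_stabilizer, hstab,
      Subgroup.index_comap_of_surjective _ (QuotientGroup.mk'_surjective _)]
    exact S.not_dvd_index
  · rintro y hy ⟨q, hq⟩
    obtain ⟨g, rfl⟩ := QuotientGroup.mk_surjective q
    rw [mem_fixedBy_quotient_mk_iff] at hq
    refine ⟨g⁻¹, hHC _ (by simpa using hq) ?_⟩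
    rwa [orderOf_conj]

theorem exists_pow_prime_pow_not_dvd_orderOf {p : ℕ} (hp : p.Prime) (x : G) :
    ∃ k : ℕ, ¬p ∣ orderOf (x ^ p ^ k) := by
  obtain ⟨k, m, hm, hk⟩ := Nat.exists_eq_pow_mul_and_not_dvd (orderOf_pos x).ne' p hp.ne_one
  refine ⟨k, ?_⟩
  rwa [orderOf_pow_of_dvd (pow_ne_zero k hp.ne_zero) (hk ▸ dvd_mul_right _ _), hk,
    Nat.mul_div_cancel_left _ (pow_pos hp.pos k)]

theorem card_fixedBy_quotient_zpowers_ne_zero (x : G) :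
    Nat.card (fixedBy (G ⧸ Subgroup.zpowers x) x) ≠ 0 := by
  have : Nonempty (fixedBy (G ⧸ Subgroup.zpowers x) x) :=
    ⟨(1 : G), (mem_fixedBy_quotient_mk_iff _ _ _).2 (by simp)⟩
  exact Nat.card_pos.ne'

end CyclicSubgroups

/-! ### Multiples of idempotent functions in a ring of integral functions -/

/-- A function `e` with values `0` and `1` has a multiple, with multiplier in the
multiplicative set `M`, in every ring `A` of integral functions that separates the points where `e`
is `1` from those where it is `0`, up to elements of `M`. -/
theorem exists_smul_mem_of_separates {X : Type*} [Finite X] (A : Subring (X → ℤ))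
    (M : Submonoid ℤ) {e : X → ℤ} (he : ∀ x, e x = 0 ∨ e x = 1)
    (h : ∀ x y, e x = 1 → e y = 0 → ∃ a ∈ A, a x - a y ∈ M) : ∃ m ∈ M, m • e ∈ A := by
  classical
  have := Fintype.ofFinite X
  choose! a haA haM using h
  have hconst : ∀ n : ℤ, (fun _ => n) ∈ A := fun n => intCast_mem A n
  -- shifting `a x y` by a constant makes it vanish at `y`;
  -- `t x` lies in `A`, vanishes where `e` does, and has a value in `M` at `x`
  let t : X → X → ℤ := fun x => ∏ y with e y = 0, (a x y - fun _ => a x y y)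
  have htA : ∀ x, e x = 1 → t x ∈ A := fun x hx => prod_mem fun y hy =>
    sub_mem (haA x y hx (Finset.mem_filter.1 hy).2) (hconst _)
  have htM : ∀ x, e x = 1 → t x x ∈ M := fun x hx => by
    simp only [t, Finset.prod_apply, Pi.sub_apply]
    exact prod_mem fun y hy => haM x y hx (Finset.mem_filter.1 hy).2
  have ht0 : ∀ x z, e z = 0 → t x z = 0 := fun x z hz => by
    simp only [t, Finset.prod_apply, Pi.sub_apply]
    exact Finset.prod_eq_zero (i := z) (by simp [hz]) (sub_self _)
  have hprod : (∏ x with e x = 1, ((fun _ => t x x) - t x)) ∈ A := prod_mem fun x hx =>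
    sub_mem (hconst _) (htA x (Finset.mem_filter.1 hx).2)
  -- the product of the functions `t x x - t x` is `0` where `e` is `1`,
  -- and `∏ t x x` where `e` is `0`
  refine ⟨∏ x with e x = 1, t x x, prod_mem fun x hx => htM x (Finset.mem_filter.1 hx).2, ?_⟩
  convert! sub_mem (hconst (∏ x with e x = 1, t x x)) hprod using 1
  funext z
  simp only [Pi.smul_apply, Pi.sub_apply, Finset.prod_apply, smul_eq_mul]
  rcases he z with hz | hz
  · simp [hz, ht0 _ z hz]
  · have h0 : ∏ x with e x = 1, (t x x - t x z) = 0 :=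
      Finset.prod_eq_zero (i := z) (by simp [hz]) (sub_self _)
    rw [hz, mul_one, h0, sub_zero]

/-! ### Idempotent class functions over subfields -/

namespace integralCharacters

open MulAction

variable {G : Type v} [Group G] [Finite G]

/-- Permutation characters separate non-conjugate cyclic subgroups of order prime to `p`
modulo `p`. That no conjugate of `⟨x⟩` is `⟨y⟩` is implied by an integral complex character `f`
with different values at `x` and `y`. -/
theorem exists_not_dvd_sub_of_not_dvd_orderOf (K : Type u) [Field K] {p : ℕ} (hp : p.Prime)
    {x y : G} (hx : ¬p ∣ orderOf x) (hy : ¬p ∣ orderOf y) {f : G → ℤ}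
    (hf : f ∈ integralCharacters ℂ G) (hxy : f x ≠ f y) :
    ∃ t ∈ integralCharacters K G, ¬(p : ℤ) ∣ t x - t y := by
  wlog hle : orderOf x ≤ orderOf y generalizing x y
  · obtain ⟨t, ht, h⟩ := this hy hx hxy.symm (le_of_not_ge hle)
    exact ⟨t, ht, by rwa [dvd_sub_comm]⟩
  obtain ⟨H, hH, hH'⟩ := exists_subgroup_card_fixedBy hp x hx
  refine ⟨_, card_fixedBy_mem K G (G ⧸ H), ?_⟩
  have hy0 : fixedBy (G ⧸ H) y = ∅ := by
    by_contra hne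
    obtain ⟨g, hg⟩ := hH' y hy (Set.nonempty_iff_ne_empty.2 hne)
    exact hxy (apply_eq_of_zpowers_eq hf g (zpowers_conj_eq_of_orderOf_le hg hle)).symm
  simpa [hy0, Int.natCast_dvd_natCast] using hH

/-- The analogue of `exists_not_dvd_sub_of_not_dvd_orderOf` without a prime: permutation characters
separate any two non-conjugate cyclic subgroups. -/
theorem exists_apply_ne (K : Type u) [Field K] {x y : G} {f : G → ℤ}
    (hf : f ∈ integralCharacters ℂ G) (hxy : f x ≠ f y) :
    ∃ t ∈ integralCharacters K G, t x ≠ t y := by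
  wlog hle : orderOf x ≤ orderOf y generalizing x y
  · obtain ⟨t, ht, h⟩ := this hxy.symm (le_of_not_ge hle)
    exact ⟨t, ht, h.symm⟩
  refine ⟨_, card_fixedBy_mem K G (G ⧸ Subgroup.zpowers x), ?_⟩
  have hy0 : fixedBy (G ⧸ Subgroup.zpowers x) y = ∅ := by
    refine Set.eq_empty_iff_forall_notMem.2 fun q hq => ?_
    obtain ⟨g, rfl⟩ := QuotientGroup.mk_surjective q
    rw [mem_fixedBy_quotient_mk_iff] at hq
    exact hxy (apply_eq_of_zpowers_eq hf g⁻¹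
      (zpowers_conj_eq_of_orderOf_le (by simpa using hq) hle)).symm
  simpa [hy0] using card_fixedBy_quotient_zpowers_ne_zero x

/-- If `d • f` is a complex character, where `f` takes the values `0` and `1`, and `p` does not
divide `d`, then some multiple of `f` by an integer prime to `p` is a character over `K`. -/
theorem exists_smul_mem_of_prime (K : Type) [Field K] [Algebra K ℂ] {f : G → ℤ}
    (hf01 : ∀ x, f x = 0 ∨ f x = 1) {d : ℤ} (hf : d • f ∈ integralCharacters ℂ G)
    {p : ℕ} (hp : p.Prime) (hd : ¬(p : ℤ) ∣ d) :
    ∃ m : ℤ, ¬(p : ℤ) ∣ m ∧ m • f ∈ integralCharacters K G := by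
  have hp' : Prime (p : ℤ) := Nat.prime_iff_prime_int.1 hp
  -- `f` does not change when an element is replaced by its component of order prime to `p`
  have hinv : ∀ x k, f (x ^ p ^ k) = f x := fun x k => by
    have h1 := dvd_apply_pow_prime_pow_sub hf x hp k
    rw [Pi.smul_apply, Pi.smul_apply, smul_eq_mul, smul_eq_mul, ← mul_sub] at h1
    have h2 := (hp'.dvd_or_dvd h1).resolve_left hd
    have hp1 : ¬(p : ℤ) ∣ 1 := hp'.not_dvd_one
    rcases hf01 x with h | h <;> rcases hf01 (x ^ p ^ k) with h' | h' <;>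
      simp_all
  refine exists_smul_mem_of_separates _
    (⟨⟨{m | ¬(p : ℤ) ∣ m}, fun ha hb hab => (hp'.dvd_or_dvd hab).elim ha hb⟩, hp'.not_dvd_one⟩ :
      Submonoid ℤ) hf01 fun x y hx hy => ?_
  obtain ⟨k, hk⟩ := exists_pow_prime_pow_not_dvd_orderOf hp x
  obtain ⟨l, hl⟩ := exists_pow_prime_pow_not_dvd_orderOf hp y
  have hd0 : d ≠ 0 := fun h => hd (h ▸ dvd_zero _)
  obtain ⟨t, ht, htxy⟩ := exists_not_dvd_sub_of_not_dvd_orderOf K hp hk hl hf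
    (by simp [hinv, hx, hy, hd0])
  have hk' := dvd_apply_pow_prime_pow_sub (le_baseChange ht) x hp k
  have hl' := dvd_apply_pow_prime_pow_sub (le_baseChange ht) y hp l
  refine ⟨t, ht, fun hdvd => htxy ?_⟩
  convert! (hdvd.add hk').sub hl' using 1
  ring

/-- Some non-zero multiple of `f` is a character over `K`. If `P` is empty, no prime ensures that
the ideal of multipliers is non-zero. -/
theorem exists_smul_mem_of_ne_zero (K : Type) [Field K] [Algebra K ℂ] {f : G → ℤ}
    (hf01 : ∀ x, f x = 0 ∨ f x = 1) {d : ℤ} (hf : d • f ∈ integralCharacters ℂ G) (hd : d ≠ 0) :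
    ∃ m : ℤ, m ≠ 0 ∧ m • f ∈ integralCharacters K G := by
  obtain ⟨m, hm, h⟩ := exists_smul_mem_of_separates (integralCharacters K G) (nonZeroDivisors ℤ)
    hf01 fun x y hx hy => by
      obtain ⟨t, ht, htxy⟩ := exists_apply_ne K hf (x := x) (y := y) (by simp [hx, hy, hd])
      exact ⟨t, ht, mem_nonZeroDivisors_of_ne_zero (sub_ne_zero.2 htxy)⟩
  exact ⟨m, nonZeroDivisors.ne_zero hm, h⟩

/-- The statement for a single prime, combined over all primes in `P`. -/
theorem exists_smul_mem (K : Type) [Field K] [Algebra K ℂ] {f : G → ℤ}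
    (hf01 : ∀ x, f x = 0 ∨ f x = 1) (P : Set Nat.Primes) {d : ℕ} (hd : d ≠ 0)
    (hdP : ∀ p ∈ P, ¬(p : ℕ) ∣ d) (hf : (d : ℤ) • f ∈ integralCharacters ℂ G) :
    ∃ m : ℕ, m ≠ 0 ∧ (∀ p ∈ P, ¬(p : ℕ) ∣ m) ∧ (m : ℤ) • f ∈ integralCharacters K G := by
  -- the multipliers that work form an ideal of `ℤ`, contained in `(p)` for no `p ∈ P`
  let I : Ideal ℤ := (integralCharacters K G).toAddSubgroup.toIntSubmodule.comap
    (LinearMap.toSpanSingleton ℤ (G → ℤ) f)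
  have hI : ∀ m, m ∈ I ↔ m • f ∈ integralCharacters K G := fun m => Iff.rfl
  obtain ⟨m, hm⟩ := (IsPrincipalIdealRing.principal I).principal
  have hdvd : ∀ n, n • f ∈ integralCharacters K G → m ∣ n := fun n hn =>
    Ideal.mem_span_singleton.1 (hm.le ((hI n).2 hn))
  refine ⟨m.natAbs, ?_, fun p hp hpm => ?_, ?_⟩
  · obtain ⟨n, hn0, hn⟩ := exists_smul_mem_of_ne_zero K hf01 hf (Nat.cast_ne_zero.2 hd)
    exact Int.natAbs_ne_zero.2 fun h => hn0 (zero_dvd_iff.1 (h ▸ hdvd n hn))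
  · obtain ⟨n, hpn, hn⟩ := exists_smul_mem_of_prime K hf01 hf p.2
      (fun h => hdP p hp (Int.natCast_dvd_natCast.1 h))
    exact hpn ((Int.natCast_dvd.2 hpm).trans (hdvd n hn))
  · rw [← hI, hm]
    exact Ideal.mem_span_singleton.2 (Int.dvd_natAbs.2 dvd_rfl)

end integralCharacters

/-! ### Localized representation rings -/

theorem inv_mem_ZLoc {P : Set Nat.Primes} {d : ℕ} (hd : d ≠ 0) (hdP : ∀ p ∈ P, ¬(p : ℕ) ∣ d) :
    (d : ℚ)⁻¹ ∈ ZLoc P := by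
  induction d using Nat.recOnMul with
  | zero => exact absurd rfl hd
  | one => simp
  | prime p hp => exact Algebra.subset_adjoin ⟨⟨p, hp⟩, fun h => hdP _ h dvd_rfl, rfl⟩
  | mul a b ha hb =>
    rw [Nat.cast_mul, mul_inv]
    exact mul_mem (ha (left_ne_zero_of_mul hd) fun p hp h => hdP p hp (h.mul_right b))
      (hb (right_ne_zero_of_mul hd) fun p hp h => hdP p hp (h.mul_left a))

theorem not_dvd_den_of_mem_ZLoc {P : Set Nat.Primes} {q : ℚ} (hq : q ∈ ZLoc P) {p : Nat.Primes}
    (hp : p ∈ P) : ¬(p : ℕ) ∣ q.den := by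
  induction hq using Algebra.adjoin_induction with
  | mem x hx =>
    obtain ⟨l, hl, rfl⟩ := hx
    rw [Rat.inv_natCast_den_of_pos l.2.pos, Nat.prime_dvd_prime_iff_eq p.2 l.2]
    exact fun h => hl (Subtype.ext h ▸ hp)
  | algebraMap n => simpa using p.2.one_lt.ne'
  | add x y _ _ hx hy =>
    exact fun h => (p.2.dvd_mul.1 (h.trans (Rat.add_den_dvd x y))).elim hx hy
  | mul x y _ _ hx hy =>
    exact fun h => (p.2.dvd_mul.1 (h.trans (Rat.mul_den_dvd x y))).elim hx hy

namespace RepRingLoc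

variable {K : Type u} {G : Type v} [Field K] [Group G] {P : Set Nat.Primes}

/-- Elements of the localized representation ring have a common denominator. -/
theorem exists_eq_tmul_inv (z : RepRingLoc K G P) :
    ∃ (x : RepRing K G) (d : ℕ) (_ : d ≠ 0) (_ : ∀ p ∈ P, ¬(p : ℕ) ∣ d)
      (h : (d : ℚ)⁻¹ ∈ ZLoc P), z = x ⊗ₜ ⟨(d : ℚ)⁻¹, h⟩ := by
  induction z using TensorProduct.induction_on with
  | zero =>
    exact ⟨0, 1, one_ne_zero, fun p _ => p.2.one_lt.ne' ∘ Nat.dvd_one.1, by simp,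
      (TensorProduct.zero_tmul _ _).symm⟩
  | tmul x q =>
    have hd : ∀ p ∈ P, ¬(p : ℕ) ∣ q.1.den := fun p hp => not_dvd_den_of_mem_ZLoc q.2 hp
    refine ⟨q.1.num • x, q.1.den, q.1.den_nz, hd, inv_mem_ZLoc q.1.den_nz hd, ?_⟩
    rw [TensorProduct.smul_tmul]
    congr 1
    refine Subtype.ext ?_
    change q.1 = q.1.num • (q.1.den : ℚ)⁻¹
    rw [zsmul_eq_mul, ← div_eq_mul_inv, Rat.num_div_den]
  | add z w hz hw =>
    obtain ⟨x, d, hd, hdP, hd', rfl⟩ := hz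
    obtain ⟨y, e, he, heP, he', rfl⟩ := hw
    have hde : ∀ p ∈ P, ¬(p : ℕ) ∣ d * e := fun p hp h =>
      (p.2.dvd_mul.1 h).elim (hdP p hp) (heP p hp)
    refine ⟨(e : ℤ) • x + (d : ℤ) • y, d * e, mul_ne_zero hd he, hde,
      inv_mem_ZLoc (mul_ne_zero hd he) hde, ?_⟩
    have hd0 : (d : ℚ) ≠ 0 := Nat.cast_ne_zero.2 hd
    have he0 : (e : ℚ) ≠ 0 := Nat.cast_ne_zero.2 he
    rw [TensorProduct.add_tmul, TensorProduct.smul_tmul, TensorProduct.smul_tmul]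
    congr 2
    · refine Subtype.ext ?_
      change (d : ℚ)⁻¹ = (e : ℤ) • ((d * e : ℕ) : ℚ)⁻¹
      rw [zsmul_eq_mul]
      push_cast
      field_simp
    · refine Subtype.ext ?_
      change (e : ℚ)⁻¹ = (d : ℤ) • ((d * e : ℕ) : ℚ)⁻¹
      rw [zsmul_eq_mul]
      push_cast
      field_simp

variable [CharZero K]

variable (K G P) in
/-- The character of an element of the localized representation ring. -/
def character : RepRingLoc K G P →+* (G → K) :=
  (Algebra.TensorProduct.productMap (RepRing.character K G).toIntAlgHom
    (((algebraMap ℚ (G → K)).comp (ZLoc P).val.toRingHom).toIntAlgHom)).toRingHom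

theorem character_tmul (x : RepRing K G) (q : ZLoc P) (g : G) :
    character K G P (x ⊗ₜ q) g = RepRing.character K G x g * (q : ℚ) := by
  refine (congrFun (Algebra.TensorProduct.productMap_apply_tmul _ _ x q) g).trans ?_
  change RepRing.character K G x g * algebraMap ℚ (G → K) q g = _
  rw [Pi.algebraMap_apply, eq_ratCast]

variable {L : Type u} [Field L] [Algebra K L] [CharZero L]

theorem character_baseChange (z : RepRingLoc K G P) (g : G) :
    character L G P (baseChange K L G P z) g = algebraMap K L (character K G P z g) := by
  obtain ⟨x, d, -, -, hd', rfl⟩ := exists_eq_tmul_inv z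
  have h : baseChange K L G P (x ⊗ₜ ⟨_, hd'⟩) = RepRing.baseChange K L G x ⊗ₜ ⟨_, hd'⟩ := rfl
  rw [h, character_tmul, character_tmul, RepRing.character_baseChange, map_mul, map_ratCast]

variable [Finite G]

theorem character_injective : Function.Injective (character K G P) := by
  refine (injective_iff_map_eq_zero _).2 fun z hz => ?_
  obtain ⟨x, d, hd, -, hd', rfl⟩ := exists_eq_tmul_inv z
  have hx : x = 0 := by
    refine (injective_iff_map_eq_zero _).1 RepRing.character_injective x (funext fun g => ?_)
    have h := congrFun hz g
    rw [character_tmul] at h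
    refine (mul_eq_zero.1 h).resolve_right ?_
    simpa using hd
  rw [hx, TensorProduct.zero_tmul]

theorem baseChange_injective : Function.Injective (baseChange K L G P) := by
  intro z w h
  refine character_injective (funext fun g => (algebraMap K L).injective ?_)
  rw [← character_baseChange, ← character_baseChange, h]

end RepRingLoc

/-! ### Idempotents of the localized representation ring -/

/-- The character of an idempotent takes the values `0` and `1`, so that a suitable multiple of it
is the character of a virtual representation over `K`. -/
theorem mem_range_baseChange_of_isIdempotentElem (K : Type) [Field K] [CharZero K] [Algebra K ℂ]
    {G : Type v} [Group G] [Finite G] {P : Set Nat.Primes} {e : RepRingLoc ℂ G P}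
    (he : IsIdempotentElem e) : e ∈ (RepRingLoc.baseChange K ℂ G P).range := by
  classical
  obtain ⟨x, d, hd, hdP, hd', rfl⟩ := RepRingLoc.exists_eq_tmul_inv e
  set χ := RepRingLoc.character ℂ G P (x ⊗ₜ ⟨_, hd'⟩) with hχ
  have hd0 : (d : ℂ) ≠ 0 := Nat.cast_ne_zero.2 hd
  have hχ01 : ∀ g, χ g = 0 ∨ χ g = 1 := fun g =>
    IsIdempotentElem.iff_eq_zero_or_one.1 (congrFun (he.map (RepRingLoc.character ℂ G P)) g)
  let f : G → ℤ := fun g => if χ g = 1 then 1 else 0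
  have hf01 : ∀ g, f g = 0 ∨ f g = 1 := fun g => by
    simp only [f]; split_ifs <;> simp
  have hfχ : ∀ g, (f g : ℂ) = χ g := fun g => by
    rcases hχ01 g with h | h <;> simp [f, h]
  have hf : (d : ℤ) • f ∈ integralCharacters ℂ G := by
    refine integralCharacters.mem_iff.2 ⟨x, fun g => ?_⟩
    have h1 := hfχ g
    rw [hχ, RepRingLoc.character_tmul] at h1
    simp [h1]
    field_simp
  obtain ⟨m, hm, hmP, hmf⟩ := integralCharacters.exists_smul_mem K hf01 P hd hdP hf
  obtain ⟨y, hy⟩ := integralCharacters.mem_iff.1 hmf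
  refine ⟨y ⊗ₜ ⟨(m : ℚ)⁻¹, inv_mem_ZLoc hm hmP⟩, ?_⟩
  refine RepRingLoc.character_injective (funext fun g => ?_)
  have hm0 : (m : ℂ) ≠ 0 := Nat.cast_ne_zero.2 hm
  rw [RepRingLoc.character_baseChange, RepRingLoc.character_tmul, hy, ← hχ, ← hfχ]
  simp
  field_simp

/-- A subring that contains all idempotents has the same primitive idempotents. -/
theorem isPrimitiveIdempotent_eq_image {R : Type*} [Ring R] (S : Subring R)
    (hS : ∀ e : R, IsIdempotentElem e → e ∈ S) :
    {e : R | IsPrimitiveIdempotent e} = Subtype.val '' {e : S | IsPrimitiveIdempotent e} := by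
  have hval : ∀ e : S, IsIdempotentElem e ↔ IsIdempotentElem (e : R) := fun e => Subtype.ext_iff
  ext e
  constructor
  · rintro ⟨hid, hne, hprim⟩
    refine ⟨⟨e, hS e hid⟩, ⟨(hval _).2 hid, fun h => hne (congrArg Subtype.val h),
      fun a b ha hb hab => ?_⟩, rfl⟩
    exact (hprim a b ((hval a).1 ha) ((hval b).1 hb) (congrArg Subtype.val hab)).imp
      Subtype.ext Subtype.ext
  · rintro ⟨e, ⟨hid, hne, hprim⟩, rfl⟩
    refine ⟨(hval e).1 hid, fun h => hne (Subtype.ext h), fun a b ha hb hab => ?_⟩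
    exact (hprim ⟨a, hS a ha⟩ ⟨b, hS b hb⟩ ((hval _).2 ha) ((hval _).2 hb) (Subtype.ext hab)).imp
      (congrArg Subtype.val) (congrArg Subtype.val)

end

theorem mainTheorem3 {G : Type*} [Group G] [Finite G] (P : Set Nat.Primes) :
    -- extension of scalars embeds the real and rational rings as subrings
    (Function.Injective (RepRingLoc.baseChange ℝ ℂ G P) ∧
      Function.Injective (RepRingLoc.baseChange ℚ ℂ G P)) ∧
    -- all primitive idempotents lie in both subrings
    (∀ e : RepRingLoc ℂ G P, IsPrimitiveIdempotent e →
      e ∈ realSubring G P ∧ e ∈ ratSubring G P) ∧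
    -- they are precisely the primitive idempotents of these subrings
    ({e : RepRingLoc ℂ G P | IsPrimitiveIdempotent e} =
      Subtype.val '' {e : realSubring G P | IsPrimitiveIdempotent e}) ∧
    ({e : RepRingLoc ℂ G P | IsPrimitiveIdempotent e} =
      Subtype.val '' {e : ratSubring G P | IsPrimitiveIdempotent e}) :=
  ⟨⟨RepRingLoc.baseChange_injective, RepRingLoc.baseChange_injective⟩,
    fun _ he => ⟨mem_range_baseChange_of_isIdempotentElem ℝ he.1,
      mem_range_baseChange_of_isIdempotentElem ℚ he.1⟩,
    isPrimitiveIdempotent_eq_image _ fun _ he => mem_range_baseChange_of_isIdempotentElem ℝ he,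
    isPrimitiveIdempotent_eq_image _ fun _ he => mem_range_baseChange_of_isIdempotentElem ℚ he⟩
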